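/- Let $\mathcal C$ and $\mathcal D$ be (not necessarily unital) $C^*$-algebras, let $\mathcal A,\mathcal B$ be $C^*$-subalgebras of $\mathcal C$, and let $\mathcal P$ be a $C^*$-subalgebra of $\mathcal D$. Here $\mathcal C\otimes^{\min}\mathcal D$ is the minimal (spatial) $C^*$-tensor product, that is, the completion of the algebraic tensor product $\mathcal C\otimes\mathcal D$ for the norm $\|z\|_{\min}=\sup_{\varphi,\psi}\|(\pi_\varphi\otimes\pi_\psi)(z)\|$, where $\varphi,\psi$ run over the states of $\mathcal C$ and $\mathcal D$ and $\pi_\varphi,\pi_\psi$ are their GNS representations; for $C^*$-subalgebras $\mathcal X\subseteq\mathcal C$ and $\mathcal Y\subseteq\mathcal D$, $\mathcal X\otimes^{\min}\mathcal Y$ is regarded as the $C^*$-subalgebra $\overline{\mathcal X\otimes\mathcal Y}$ of $\mathcal C\otimes^{\min}\mathcal D$. For subalgebras $\mathcal X,\mathcal Y$ of a $C^*$-algebra with closed unit balls $B_1(\mathcal X),B_1(\mathcal Y)$, let $d_{KK}(\mathcal X,\mathcal Y)$ be the Hausdorff distance between $B_1(\mathcal X)$ and $B_1(\mathcal Y)$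 (Kadison–Kastler distance), and let $d_0(\mathcal X,\mathcal Y)$ be the infimum of all $\gamma>0$ such that every $x\in B_1(\mathcal X)$ satisfies $\|x-y\|\le\gamma$ for some $y\in\mathcal Y$, and every $y\in B_1(\mathcal Y)$ satisfies $\|y-x\|\le\gamma$ for some $x\in\mathcal X$ (Christensen distance). Suppose that there exists a conditional expectation $E$ from $\mathcal D$ onto $\mathcal P$, i.e. a positive contractive linear map $E:\mathcal D\to\mathcal P$ with $E(p)=p$, $E(pd)=pE(d)$ and $E(dp)=E(d)p$ for all $p\in\mathcal P$, $d\in\mathcal D$. Then \[ d_0(\mathcal A\otimes^{\min}\mathcal P,\mathcal B\otimes^{\min}\mathcal P)\le d_0(\mathcal A\otimes^{\min}\mathcal D,\mathcal B\otimes^{\min}\mathcal D) \] and \[ d_{KK}(\mathcal A\otimes^{\min}\mathcal P,\mathcal B\otimes^{\min}\mathcal P)\le d_{KK}(\mathcal A\otimes^{\min}\mathcal D,\mathcal B\otimes^{\min}\mathcal D). \] -/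

import Mathlib

open scoped TensorProduct ComplexOrder ENNReal

noncomputable section

/-! ## The minimal (spatial) tensor product of two C⋆-algebras -/

namespace MinimalTensor

section HilbertSpaces

variable (H K : Type*) [NormedAddCommGroup H] [InnerProductSpace ℂ H]
  [NormedAddCommGroup K] [InnerProductSpace ℂ K]

/-- The Hilbert space tensor product: the completion of the algebraic tensor product for the inner
product `⟪a ⊗ b, a' ⊗ b'⟫ = ⟪a, a'⟫ * ⟪b, b'⟫`. -/
def HilbertTensor : Type _ := UniformSpace.Completion (H ⊗[ℂ] K)

instance : NormedAddCommGroup (HilbertTensor H K) :=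
  inferInstanceAs (NormedAddCommGroup (UniformSpace.Completion (H ⊗[ℂ] K)))

instance : InnerProductSpace ℂ (HilbertTensor H K) :=
  inferInstanceAs (InnerProductSpace ℂ (UniformSpace.Completion (H ⊗[ℂ] K)))

instance : CompleteSpace (HilbertTensor H K) :=
  inferInstanceAs (CompleteSpace (UniformSpace.Completion (H ⊗[ℂ] K)))

/-- The inclusion of the algebraic tensor product in the Hilbert space tensor product. -/
def HilbertTensor.incl : H ⊗[ℂ] K →ₗᵢ[ℂ] HilbertTensor H K :=
  UniformSpace.Completion.toComplₗᵢ

variable {H K}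

theorem HilbertTensor.denseRange_incl : DenseRange (HilbertTensor.incl H K) :=
  UniformSpace.Completion.denseRange_coe

theorem HilbertTensor.clm_ext {F : Type*} [NormedAddCommGroup F] [NormedSpace ℂ F]
    {f g : HilbertTensor H K →L[ℂ] F}
    (h : ∀ x, f (HilbertTensor.incl H K x) = g (HilbertTensor.incl H K x)) : f = g :=
  ContinuousLinearMap.ext fun x => congrFun
    (HilbertTensor.denseRange_incl.equalizer f.continuous g.continuous (funext h)) x

/-- The operator `S ⊗ T` on the Hilbert space tensor product. -/
def opTensor (S : H →L[ℂ] H) (T : K →L[ℂ] K) : HilbertTensor H K →L[ℂ] HilbertTensor H K :=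
  (TensorProduct.mapL S T).completion

@[simp]
theorem opTensor_incl (S : H →L[ℂ] H) (T : K →L[ℂ] K) (x : H ⊗[ℂ] K) :
    opTensor S T (HilbertTensor.incl H K x) =
      HilbertTensor.incl H K (TensorProduct.mapL S T x) :=
  ContinuousLinearMap.completion_apply_coe _ _

theorem opTensor_mul (S S' : H →L[ℂ] H) (T T' : K →L[ℂ] K) :
    opTensor (S * S') (T * T') = opTensor S T * opTensor S' T' :=
  HilbertTensor.clm_ext fun x => by
    rw [mul_apply_eq_comp, opTensor_incl, opTensor_incl, opTensor_incl,
      TensorProduct.mapL_mul, mul_apply_eq_comp]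

theorem opTensor_star [CompleteSpace H] [CompleteSpace K] (S : H →L[ℂ] H) (T : K →L[ℂ] K) :
    opTensor (star S) (star T) = star (opTensor S T) := by
  rw [ContinuousLinearMap.star_eq_adjoint (opTensor S T)]
  refine (ContinuousLinearMap.eq_adjoint_iff _ _).mpr fun x y => ?_
  refine HilbertTensor.denseRange_incl.induction_on₂
    (p := fun x y => inner ℂ (opTensor (star S) (star T) x) y = inner ℂ x (opTensor S T y))
    (isClosed_eq (by fun_prop) (by fun_prop)) (fun x y => ?_) x y
  rw [opTensor_incl, opTensor_incl, LinearIsometry.inner_map_map, LinearIsometry.inner_map_map]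
  induction x using TensorProduct.induction_on with
  | zero => simp
  | add x₁ x₂ h₁ h₂ => simp only [map_add, inner_add_left, h₁, h₂]
  | tmul a b =>
    induction y using TensorProduct.induction_on with
    | zero => simp
    | add y₁ y₂ h₁ h₂ => simp only [map_add, inner_add_right, h₁, h₂]
    | tmul a' b' =>
      simp [ContinuousLinearMap.star_eq_adjoint, ContinuousLinearMap.adjoint_inner_left]

theorem norm_opTensor_le (S : H →L[ℂ] H) (T : K →L[ℂ] K) : ‖opTensor S T‖ ≤ ‖S‖ * ‖T‖ := by
  refine ContinuousLinearMap.opNorm_le_bound _ (by positivity) fun x => ?_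
  refine HilbertTensor.denseRange_incl.induction_on
    (p := fun x => ‖opTensor S T x‖ ≤ ‖S‖ * ‖T‖ * ‖x‖) x
    (isClosed_le (by fun_prop) (by fun_prop)) fun x => ?_
  rw [opTensor_incl, LinearIsometry.norm_map, LinearIsometry.norm_map]
  exact ((TensorProduct.mapL S T).le_opNorm x).trans
    (mul_le_mul_of_nonneg_right (TensorProduct.norm_mapL_le S T) (norm_nonneg x))

end HilbertSpaces

section Construction

/-- A state of a (possibly non-unital) C⋆-algebra: a positive linear functional of norm one. -/
structure State (C : Type*) [NonUnitalCStarAlgebra C] where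
  /-- The underlying bounded linear functional. -/
  toCLM : C →L[ℂ] ℂ
  nonneg : ∀ c : C, 0 ≤ toCLM (star c * c)
  norm_eq_one : ‖toCLM‖ = 1

-- The positive cone `{star c * c}` of a C⋆-algebra, as a partial order.
attribute [local instance] CStarAlgebra.spectralOrder CStarAlgebra.spectralOrderedRing

variable {C D : Type*} [NonUnitalCStarAlgebra C] [NonUnitalCStarAlgebra D]

/-- A state, as a positive linear map. -/
def State.functional (φ : State C) : C →ₚ[ℂ] ℂ :=
  PositiveLinearMap.mk₀ φ.toCLM.toLinearMap fun x hx => by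
    obtain ⟨c, rfl⟩ := CStarAlgebra.nonneg_iff_eq_star_mul_self.mp hx
    exact φ.nonneg c

/-- The Hilbert space of the GNS representation of a state. -/
abbrev State.Hilb (φ : State C) : Type _ := φ.functional.GNS

/-- The GNS representation `π_φ` of a state. -/
abbrev State.rep (φ : State C) : C →⋆ₙₐ[ℂ] (φ.Hilb →L[ℂ] φ.Hilb) :=
  φ.functional.gnsNonUnitalStarAlgHom

/-- The Hilbert space tensor product of the GNS spaces of two states. -/
abbrev PairHilb (φ : State C) (ψ : State D) : Type _ := HilbertTensor φ.Hilb ψ.Hilb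

/-- The representation `π_φ ⊗ π_ψ` of the algebraic tensor product, as a linear map. -/
def pairRepLinear (φ : State C) (ψ : State D) :
    C ⊗[ℂ] D →ₗ[ℂ] (PairHilb φ ψ →L[ℂ] PairHilb φ ψ) :=
  TensorProduct.lift <| LinearMap.mk₂ ℂ (fun c d => opTensor (φ.rep c) (ψ.rep d))
    (fun c₁ c₂ d => HilbertTensor.clm_ext fun x => by
      rw [add_apply]
      simp [TensorProduct.map_add_left])
    (fun r c d => HilbertTensor.clm_ext fun x => by
      rw [smul_apply]
      simp [TensorProduct.map_smul_left])
    (fun c d₁ d₂ => HilbertTensor.clm_ext fun x => by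
      rw [add_apply]
      simp [TensorProduct.map_add_right])
    (fun r c d => HilbertTensor.clm_ext fun x => by
      rw [smul_apply]
      simp [TensorProduct.map_smul_right])

theorem pairRepLinear_tmul (φ : State C) (ψ : State D) (c : C) (d : D) :
    pairRepLinear φ ψ (c ⊗ₜ d) = opTensor (φ.rep c) (ψ.rep d) := rfl

/-- The representation `π_φ ⊗ π_ψ` of the algebraic tensor product `C ⊗ D`. -/
def pairRep (φ : State C) (ψ : State D) :
    C ⊗[ℂ] D →⋆ₙₐ[ℂ] (PairHilb φ ψ →L[ℂ] PairHilb φ ψ) where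
  toFun := pairRepLinear φ ψ
  map_smul' := map_smul _
  map_zero' := map_zero _
  map_add' := map_add _
  map_mul' x y := by
    induction x using TensorProduct.induction_on with
    | zero => simp
    | add x₁ x₂ h₁ h₂ => simp only [map_add, add_mul, h₁, h₂]
    | tmul a b =>
      induction y using TensorProduct.induction_on with
      | zero => simp
      | add y₁ y₂ h₁ h₂ => simp only [map_add, mul_add, h₁, h₂]
      | tmul a' b' =>
        simp only [Algebra.TensorProduct.tmul_mul_tmul, pairRepLinear_tmul, map_mul, opTensor_mul]
  map_star' x := by
    induction x using TensorProduct.induction_on with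
    | zero => simp
    | add x₁ x₂ h₁ h₂ => simp only [map_add, star_add, h₁, h₂]
    | tmul a b => simp only [TensorProduct.star_tmul, pairRepLinear_tmul, map_star, opTensor_star]

theorem exists_norm_pairRep_le (z : C ⊗[ℂ] D) :
    ∃ K : ℝ, ∀ i : State C × State D, ‖pairRep i.1 i.2 z‖ ≤ K := by
  induction z using TensorProduct.induction_on with
  | zero => exact ⟨0, fun i => by simp⟩
  | add x y hx hy =>
    obtain ⟨K, hK⟩ := hx
    obtain ⟨L, hL⟩ := hy
    exact ⟨K + L, fun i => by
      rw [map_add]; exact (norm_add_le _ _).trans (add_le_add (hK i) (hL i))⟩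
  | tmul c d =>
    refine ⟨‖c‖ * ‖d‖, fun i => (norm_opTensor_le _ _).trans ?_⟩
    gcongr
    · exact NonUnitalStarAlgHom.norm_apply_le i.1.rep c
    · exact NonUnitalStarAlgHom.norm_apply_le i.2.rep d

variable (C D) in
/-- The C⋆-algebra of bounded families of operators, indexed by the pairs of states. -/
def BigAlgebra : Type _ :=
  lp (fun i : State C × State D => PairHilb i.1 i.2 →L[ℂ] PairHilb i.1 i.2) ∞

instance : NonUnitalCStarAlgebra (BigAlgebra C D) :=
  inferInstanceAs (NonUnitalCStarAlgebra
    (lp (fun i : State C × State D => PairHilb i.1 i.2 →L[ℂ] PairHilb i.1 i.2) ∞))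

variable (C D) in
/-- The direct sum of all the representations `π_φ ⊗ π_ψ`; thus
`‖spatialRep C D z‖ = sup_{φ, ψ} ‖(π_φ ⊗ π_ψ) z‖` is the minimal C⋆-norm of `z`. -/
def spatialRep : C ⊗[ℂ] D →⋆ₙₐ[ℂ] BigAlgebra C D where
  toFun z := ⟨fun i => pairRep i.1 i.2 z, by
    obtain ⟨K, hK⟩ := exists_norm_pairRep_le z
    exact memℓp_infty ⟨K, by rintro _ ⟨i, rfl⟩; exact hK i⟩⟩
  map_smul' r z := lp.ext (funext fun i => map_smul (pairRep i.1 i.2) r z)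
  map_zero' := lp.ext (funext fun i => map_zero (pairRep i.1 i.2))
  map_add' x y := lp.ext (funext fun i => map_add (pairRep i.1 i.2) x y)
  map_mul' x y := lp.ext (funext fun i => map_mul (pairRep i.1 i.2) x y)
  map_star' x := lp.ext (funext fun i => map_star (pairRep i.1 i.2) x)

/-- The functional `φ ⊗ ψ` on the algebraic tensor product. -/
def stateTensor (φ : State C) (ψ : State D) : C ⊗[ℂ] D →ₗ[ℂ] ℂ :=
  TensorProduct.lid ℂ ℂ ∘ₗ TensorProduct.map φ.toCLM.toLinearMap ψ.toCLM.toLinearMap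

/-- The image in the GNS space of an element of the algebra. -/
def State.vec (φ : State C) : C →ₗ[ℂ] φ.Hilb :=
  (UniformSpace.Completion.toComplₗᵢ (𝕜 := ℂ) (E := φ.functional.PreGNS)).toLinearMap ∘ₗ
    φ.functional.toPreGNS.toLinearMap

theorem State.denseRange_vec (φ : State C) : DenseRange φ.vec :=
  (UniformSpace.Completion.denseRange_coe (α := φ.functional.PreGNS)).comp
    φ.functional.toPreGNS.surjective.denseRange (UniformSpace.Completion.continuous_coe _)

theorem State.inner_vec (φ : State C) (a b : C) :
    inner ℂ (φ.vec a) (φ.vec b) = φ.toCLM (star a * b) :=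
  UniformSpace.Completion.inner_coe (𝕜 := ℂ) (E := φ.functional.PreGNS) _ _

theorem State.rep_vec (φ : State C) (a b : C) : φ.rep a (φ.vec b) = φ.vec (a * b) :=
  φ.functional.gnsNonUnitalStarAlgHom_apply_coe

/-- The image in the Hilbert space of `π_φ ⊗ π_ψ` of an element of the algebraic tensor product. -/
def pairVec (φ : State C) (ψ : State D) : C ⊗[ℂ] D →ₗ[ℂ] PairHilb φ ψ :=
  (HilbertTensor.incl φ.Hilb ψ.Hilb).toLinearMap ∘ₗ TensorProduct.map φ.vec ψ.vec

theorem inner_pairVec (φ : State C) (ψ : State D) (x y : C ⊗[ℂ] D) :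
    inner ℂ (pairVec φ ψ x) (pairVec φ ψ y) = stateTensor φ ψ (star x * y) := by
  induction x using TensorProduct.induction_on with
  | zero => simp
  | add x₁ x₂ h₁ h₂ => simp only [map_add, inner_add_left, h₁, h₂, star_add, add_mul]
  | tmul a b =>
    induction y using TensorProduct.induction_on with
    | zero => simp
    | add y₁ y₂ h₁ h₂ => simp only [map_add, inner_add_right, h₁, h₂, mul_add]
    | tmul a' b' => simp [pairVec, stateTensor, State.inner_vec]

theorem pairRep_pairVec (φ : State C) (ψ : State D) (z w : C ⊗[ℂ] D) :
    pairRep φ ψ z (pairVec φ ψ w) = pairVec φ ψ (z * w) := by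
  induction z using TensorProduct.induction_on with
  | zero => simp
  | add x₁ x₂ h₁ h₂ => rw [map_add, add_apply, h₁, h₂, add_mul, map_add]
  | tmul a b =>
    induction w using TensorProduct.induction_on with
    | zero => simp
    | add y₁ y₂ h₁ h₂ => simp only [map_add, h₁, h₂, mul_add]
    | tmul a' b' =>
      change opTensor (φ.rep a) (ψ.rep b) (HilbertTensor.incl _ _ (φ.vec a' ⊗ₜ ψ.vec b')) = _
      rw [opTensor_incl, TensorProduct.mapL_tmul, State.rep_vec, State.rep_vec,
        Algebra.TensorProduct.tmul_mul_tmul]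
      rfl

theorem denseRange_pairVec (φ : State C) (ψ : State D) : DenseRange (pairVec φ ψ) := by
  have h : DenseRange (TensorProduct.map φ.vec ψ.vec) := by
    intro x
    change x ∈ closure ((LinearMap.range (TensorProduct.map φ.vec ψ.vec) :
      Submodule ℂ (φ.Hilb ⊗[ℂ] ψ.Hilb)) : Set (φ.Hilb ⊗[ℂ] ψ.Hilb))
    rw [← Submodule.topologicalClosure_coe, SetLike.mem_coe]
    induction x using TensorProduct.induction_on with
    | zero => exact zero_mem _
    | add x y hx hy => exact add_mem hx hy
    | tmul a b =>
      have hab := (φ.denseRange_vec.prodMap ψ.denseRange_vec) (a, b)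
      refine closure_mono ?_ (map_mem_closure
        (f := fun p : φ.Hilb × ψ.Hilb => p.1 ⊗ₜ[ℂ] p.2) TensorProduct.continuous_tmul hab
        (t := Set.range (TensorProduct.map φ.vec ψ.vec)) ?_)
      · rintro _ ⟨z, rfl⟩
        exact ⟨z, rfl⟩
      · rintro _ ⟨⟨c, d⟩, rfl⟩
        exact ⟨c ⊗ₜ d, rfl⟩
  exact HilbertTensor.denseRange_incl.comp h (HilbertTensor.incl _ _).continuous

theorem norm_pairVec (φ : State C) (ψ : State D) (w : C ⊗[ℂ] D) :
    ‖pairVec φ ψ w‖ = √(stateTensor φ ψ (star w * w)).re := by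
  rw [← inner_pairVec, norm_eq_sqrt_re_inner (𝕜 := ℂ)]
  rfl

theorem norm_spatialRep (z : C ⊗[ℂ] D) :
    ‖spatialRep C D z‖ = ⨆ i : State C × State D, ‖pairRep i.1 i.2 z‖ := rfl

/-- The minimal C⋆-norm of the algebraic tensor product, expressed through states of the two
algebras:
`‖z‖ = sup (φ ⊗ ψ)(w⋆ z⋆ z w) ^ (1/2) / (φ ⊗ ψ)(w⋆ w) ^ (1/2)`. -/
theorem norm_spatialRep_eq_sSup (z : C ⊗[ℂ] D) :
    ‖spatialRep C D z‖ = sSup {r : ℝ | ∃ (φ : State C) (ψ : State D) (w : C ⊗[ℂ] D),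
      stateTensor φ ψ (star w * w) ≠ 0 ∧
      r = √(stateTensor φ ψ (star w * star z * z * w)).re /
        √(stateTensor φ ψ (star w * w)).re} := by
  obtain ⟨K, hK⟩ := exists_norm_pairRep_le z
  have hbdd : BddAbove (Set.range fun i : State C × State D => ‖pairRep i.1 i.2 z‖) :=
    ⟨K, by rintro _ ⟨i, rfl⟩; exact hK i⟩
  have key (φ : State C) (ψ : State D) (w : C ⊗[ℂ] D) :
      √(stateTensor φ ψ (star w * star z * z * w)).re = ‖pairRep φ ψ z (pairVec φ ψ w)‖ := by
    rw [pairRep_pairVec, norm_pairVec, star_mul, mul_assoc, mul_assoc]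
  set R : Set ℝ := {r : ℝ | ∃ (φ : State C) (ψ : State D) (w : C ⊗[ℂ] D),
      stateTensor φ ψ (star w * w) ≠ 0 ∧
      r = √(stateTensor φ ψ (star w * star z * z * w)).re /
        √(stateTensor φ ψ (star w * w)).re}
  have hle : ∀ r ∈ R, r ≤ ‖spatialRep C D z‖ := by
    rintro r ⟨φ, ψ, w, -, rfl⟩
    rw [key, ← norm_pairVec]
    exact (ContinuousLinearMap.ratio_le_opNorm _ _).trans (le_ciSup hbdd (φ, ψ))
  refine le_antisymm ?_ (Real.sSup_le hle (norm_nonneg _))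
  have hR : 0 ≤ sSup R := Real.sSup_nonneg (by rintro r ⟨φ, ψ, w, -, rfl⟩; positivity)
  refine Real.iSup_le (fun i => ContinuousLinearMap.opNorm_le_bound _ hR fun x => ?_) hR
  refine (denseRange_pairVec i.1 i.2).induction_on
    (p := fun x => ‖pairRep i.1 i.2 z x‖ ≤ sSup R * ‖x‖) x
    (isClosed_le (by fun_prop) (by fun_prop)) fun w => ?_
  by_cases hw : pairVec i.1 i.2 w = 0
  · simp [hw]
  · rw [← div_le_iff₀ (norm_pos_iff.mpr hw)]
    refine le_csSup ⟨_, hle⟩ ⟨i.1, i.2, w, ?_, ?_⟩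
    · rw [← inner_pairVec]
      exact inner_self_ne_zero.mpr hw
    · rw [key, ← norm_pairVec]

end Construction

section Definitions

variable (C D : Type*) [NonUnitalCStarAlgebra C] [NonUnitalCStarAlgebra D]

/-- The minimal tensor product as a C⋆-subalgebra of `BigAlgebra C D`: the closure of the image of
the algebraic tensor product, i.e. its completion for the minimal norm. -/
def minTensorSubalgebra : NonUnitalStarSubalgebra ℂ (BigAlgebra C D) :=
  (NonUnitalStarAlgHom.range (spatialRep C D)).topologicalClosure

instance : IsClosed (minTensorSubalgebra C D : Set (BigAlgebra C D)) :=
  NonUnitalStarSubalgebra.isClosed_topologicalClosure _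

/-- The minimal (spatial) tensor product of two C⋆-algebras. -/
def MinTensor : Type _ := minTensorSubalgebra C D

instance : NonUnitalCStarAlgebra (MinTensor C D) :=
  inferInstanceAs (NonUnitalCStarAlgebra (minTensorSubalgebra C D))

/-- The canonical ⋆-homomorphism, with dense range, from the algebraic tensor product to the
minimal tensor product. -/
def ofAlgebraic : C ⊗[ℂ] D →⋆ₙₐ[ℂ] MinTensor C D :=
  NonUnitalStarAlgHom.codRestrict (spatialRep C D) (minTensorSubalgebra C D) fun z =>
    NonUnitalStarSubalgebra.le_topologicalClosure _
      ((NonUnitalStarAlgHom.mem_range (spatialRep C D)).mpr ⟨z, rfl⟩)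

theorem norm_ofAlgebraic (z : C ⊗[ℂ] D) : ‖ofAlgebraic C D z‖ = ‖spatialRep C D z‖ := rfl

end Definitions

variable {C D : Type*} [NonUnitalCStarAlgebra C] [NonUnitalCStarAlgebra D]

/-- The algebraic tensor product of ⋆-subalgebras `A ⊆ C` and `P ⊆ D`, inside `C ⊗ D`. -/
def algTensor (A : NonUnitalStarSubalgebra ℂ C) (P : NonUnitalStarSubalgebra ℂ D) :
    NonUnitalStarSubalgebra ℂ (C ⊗[ℂ] D) where
  __ := Submodule.span ℂ {z : C ⊗[ℂ] D | ∃ a ∈ A, ∃ p ∈ P, a ⊗ₜ[ℂ] p = z}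
  mul_mem' {x y} hx hy := by
    induction hx using Submodule.span_induction with
    | zero => simp
    | add x₁ x₂ _ _ h₁ h₂ => rw [add_mul]; exact Submodule.add_mem _ h₁ h₂
    | smul r x _ h => rw [smul_mul_assoc]; exact Submodule.smul_mem _ r h
    | mem x hx =>
      obtain ⟨a, ha, p, hp, rfl⟩ := hx
      induction hy using Submodule.span_induction with
      | zero => simp
      | add y₁ y₂ _ _ h₁ h₂ => rw [mul_add]; exact Submodule.add_mem _ h₁ h₂
      | smul r x _ h => rw [mul_smul_comm]; exact Submodule.smul_mem _ r h
      | mem y hy =>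
        obtain ⟨a', ha', p', hp', rfl⟩ := hy
        exact Submodule.subset_span ⟨a * a', mul_mem ha ha', p * p', mul_mem hp hp', by simp⟩
  star_mem' {x} hx := by
    induction hx using Submodule.span_induction with
    | zero => simp
    | add x₁ x₂ _ _ h₁ h₂ => rw [star_add]; exact Submodule.add_mem _ h₁ h₂
    | smul r x _ h => rw [star_smul]; exact Submodule.smul_mem _ _ h
    | mem x hx =>
      obtain ⟨a, ha, p, hp, rfl⟩ := hx
      exact Submodule.subset_span ⟨star a, star_mem ha, star p, star_mem hp, rfl⟩

/-- `A ⊗min P` as a C⋆-subalgebra of `C ⊗min D`: the norm closure of the algebraic tensor product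
`A ⊗ P`. -/
def minTensorSub (A : NonUnitalStarSubalgebra ℂ C) (P : NonUnitalStarSubalgebra ℂ D) :
    NonUnitalStarSubalgebra ℂ (MinTensor C D) :=
  ((algTensor A P).map (ofAlgebraic C D)).topologicalClosure

end MinimalTensor

/-! ## Distances between subalgebras -/

section Distances

variable {M : Type*} [NonUnitalCStarAlgebra M]

/-- The closed unit ball of a subalgebra, as a subset of the ambient algebra. -/
def unitBall (A : NonUnitalStarSubalgebra ℂ M) : Set M := {x | x ∈ A ∧ ‖x‖ ≤ 1}

/-- The Kadison-Kastler distance: the Hausdorff distance between the closed unit balls. -/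
def distKK (A B : NonUnitalStarSubalgebra ℂ M) : ℝ :=
  Metric.hausdorffDist (unitBall A) (unitBall B)

/-- The near inclusion `A ⊆_γ B`: each element of the unit ball of `A` is within `γ` of `B`. -/
def NearIncl (γ : ℝ) (A B : NonUnitalStarSubalgebra ℂ M) : Prop :=
  ∀ x ∈ unitBall A, ∃ y ∈ B, ‖x - y‖ ≤ γ

/-- The Christensen distance: the infimum of the `γ > 0` such that `A ⊆_γ B` and `B ⊆_γ A`. -/
def distC (A B : NonUnitalStarSubalgebra ℂ M) : ℝ :=
  sInf {γ : ℝ | 0 < γ ∧ NearIncl γ A B ∧ NearIncl γ B A}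

end Distances

/-- `E : D → D` is a conditional expectation of the C⋆-algebra `D` onto its C⋆-subalgebra `P`: a
positive contractive linear `P`-bimodule map with values in `P` that restricts to the identity of
`P`. -/
structure IsConditionalExpectation {D : Type*} [NonUnitalCStarAlgebra D]
    (P : NonUnitalStarSubalgebra ℂ D) (E : D →ₗ[ℂ] D) : Prop where
  mem : ∀ d, E d ∈ P
  apply_of_mem : ∀ p ∈ P, E p = p
  norm_le : ∀ d, ‖E d‖ ≤ ‖d‖
  positive : ∀ d, ∃ p ∈ P, E (star d * d) = star p * p
  map_mul_left : ∀ p ∈ P, ∀ d, E (p * d) = p * E d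
  map_mul_right : ∀ d, ∀ p ∈ P, E (d * p) = E d * p

end

/-! The map `F = id ⊗ E` on `C ⊗min D` is a contraction. It sends `A ⊗min D` into `A ⊗min P` and
fixes `A ⊗min P` pointwise, and likewise for `B`. If `x ∈ A ⊗min P` is close to `y ∈ B ⊗min D`, then
`x - F y = F (x - y)`, so `F y ∈ B ⊗min P` is at least as close, and it stays in the unit ball if
`y` was there. Both inequalities follow at once.

The substance is the contractivity of `id ⊗ E` (`norm_spatialRep_lTensor_le`). For a finite
orthonormal family `b` in the GNS space of a state `φ` of `C`, slicing `z` by the functionals `⟨b i,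
π_φ(·) b j⟩` gives a matrix over `D`. The minimal norm of `z` dominates the norms of all such
matrices (`norm_sliceMatrix_le`), and any common bound for them bounds `π_φ ⊗ π_ψ` at `z`
(`norm_pairRep_le_of_forall_sliceMatrix`). Under slicing, `id ⊗ E` becomes `E` applied entrywise, so
it suffices that `E` is completely contractive, which follows from the bimodule property
(`IsConditionalExpectation.norm_matrix_map_le`). -/

noncomputable section

/-! ### States separate the points of a C⋆-algebra -/

section States

attribute [local instance] CStarAlgebra.spectralOrder CStarAlgebra.spectralOrderedRing

/-- Adding `i t` to `x` increases the squared norm by at most `t ^ 2`, whereas it changes `(Im f x)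
^ 2` by `t ^ 2 + 2 t Im f x`. The linear term must therefore vanish. -/
theorem im_apply_eq_zero_of_isSelfAdjoint {U : Type*} [CStarAlgebra U] [Nontrivial U] (f : U →L[ℂ] ℂ)
    (hf : ‖f‖ ≤ 1) (h1 : f 1 = 1) {x : U} (hx : IsSelfAdjoint x) : (f x).im = 0 := by
  have key (t : ℝ) : ((f x).im + t) ^ 2 ≤ ‖x‖ ^ 2 + t ^ 2 := by
    have h2 : f (x + (t * Complex.I : ℂ) • 1) = f x + t * Complex.I := by simp [h1]
    have h3 : ‖x + (t * Complex.I : ℂ) • (1 : U)‖ ^ 2 ≤ ‖x‖ ^ 2 + t ^ 2 := by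
      have h4 : star (x + (t * Complex.I : ℂ) • (1 : U)) * (x + (t * Complex.I : ℂ) • 1) =
          x * x + ((t ^ 2 : ℝ) : ℂ) • (1 : U) := by
        have h5 : (t * Complex.I : ℂ) * (t * Complex.I) = -((t ^ 2 : ℝ) : ℂ) := by
          push_cast
          linear_combination (t : ℂ) ^ 2 * Complex.I_mul_I
        have h6 : star (t * Complex.I : ℂ) = -(t * Complex.I) := by simp
        rw [star_add, hx.star_eq, star_smul, star_one, h6, add_mul, mul_add, mul_add,
          smul_mul_smul_comm, neg_mul, h5, neg_neg, one_mul, mul_smul_comm, smul_mul_assoc, neg_smul,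
          mul_one, one_mul]
        abel
      rw [sq, ← CStarRing.norm_star_mul_self, h4]
      refine (norm_add_le _ _).trans (add_le_add ((norm_mul_le _ _).trans_eq (sq _).symm) ?_)
      rw [norm_smul, Complex.norm_real, Real.norm_of_nonneg (sq_nonneg t)]
      rw [CStarRing.norm_one, mul_one]
    have h6 : ‖f (x + (t * Complex.I : ℂ) • 1)‖ ≤ ‖x + (t * Complex.I : ℂ) • (1 : U)‖ :=
      (f.le_opNorm _).trans (mul_le_of_le_one_left (norm_nonneg _) hf)
    have h7 := Complex.abs_im_le_norm (f (x + (t * Complex.I : ℂ) • 1))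
    rw [h2] at h6 h7
    have h8 : (f x + t * Complex.I).im = (f x).im + t := by simp
    rw [h8] at h7
    rw [← sq_abs]
    exact (pow_le_pow_left₀ (abs_nonneg _) (h7.trans h6) 2).trans h3
  by_contra hne
  -- With this `t` the cross term equals `2 ‖x‖ ^ 2`, which leaves `(f x).im ^ 2 + ‖x‖ ^ 2 ≤ 0`.
  have := key ((‖x‖ ^ 2) / (f x).im)
  have h9 : (f x).im * (‖x‖ ^ 2 / (f x).im) = ‖x‖ ^ 2 := mul_div_cancel₀ _ hne
  have : 0 < (f x).im ^ 2 := by positivity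
  nlinarith [sq_nonneg ‖x‖]

/-- From `0 ≤ x ≤ ‖x‖ 1` the element `‖x‖ 1 - x` has norm at most `‖x‖`; applying `f` gives `‖x‖ -
Re f x ≤ ‖x‖`. -/
theorem apply_nonneg_of_apply_one {U : Type*} [CStarAlgebra U] [Nontrivial U] (f : U →L[ℂ] ℂ)
    (hf : ‖f‖ ≤ 1) (h1 : f 1 = 1) {x : U} (hx : 0 ≤ x) : 0 ≤ f x := by
  have him := im_apply_eq_zero_of_isSelfAdjoint f hf h1 (IsSelfAdjoint.of_nonneg hx)
  have hle : x ≤ algebraMap ℝ U ‖x‖ := IsSelfAdjoint.le_algebraMap_norm_self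
  have hn : ‖algebraMap ℝ U ‖x‖ - x‖ ≤ ‖x‖ := by
    refine (CStarAlgebra.norm_le_norm_of_nonneg_of_le (sub_nonneg.mpr hle)
      (sub_le_self _ hx)).trans ?_
    rw [Algebra.algebraMap_eq_smul_one, norm_smul, norm_norm]
    rw [CStarRing.norm_one, mul_one]
  have h2 : ‖f (algebraMap ℝ U ‖x‖ - x)‖ ≤ ‖x‖ :=
    (f.le_opNorm _).trans ((mul_le_of_le_one_left (norm_nonneg _) hf).trans hn)
  have h3 : f (algebraMap ℝ U ‖x‖ - x) = ‖x‖ - f x := by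
    rw [map_sub, IsScalarTower.algebraMap_apply ℝ ℂ U, Algebra.algebraMap_eq_smul_one, map_smul, h1]
    simp
  rw [h3] at h2
  have h4 := (Complex.re_le_norm _).trans h2
  rw [Complex.nonneg_iff]
  simp at h4
  exact ⟨h4, him.symm⟩

/-- Modulo the line spanned by `k - a`, the class of `1` has norm one: a multiple of `k - a` at
distance less than one from `1` would be invertible. Hahn–Banach in the quotient gives `f`, and `a ≡
k 1` there forces `f a = k`. -/
theorem exists_apply_one_of_spectrum {U : Type*} [CStarAlgebra U] [Nontrivial U] (a : U) {k : ℂ}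
    (hk : k ∈ spectrum ℂ a) : ∃ f : U →L[ℂ] ℂ, ‖f‖ ≤ 1 ∧ f 1 = 1 ∧ f a = k := by
  set S : Submodule ℂ U := Submodule.span ℂ {algebraMap ℂ U k - a} with hS
  have h1 : 1 ≤ ‖(Submodule.Quotient.mk 1 : U ⧸ S)‖ := by
    refine QuotientAddGroup.le_norm_iff.mpr fun m hm => ?_
    by_contra! hlt
    obtain ⟨β, hβ⟩ := Submodule.mem_span_singleton.mp
      ((Submodule.Quotient.eq S).mp (show (Submodule.Quotient.mk 1 : U ⧸ S) =
        Submodule.Quotient.mk m from hm.symm))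
    have hu : IsUnit (β • (algebraMap ℂ U k - a)) := hβ ▸ isUnit_one_sub_of_norm_lt_one hlt
    rcases eq_or_ne β 0 with rfl | hβ0
    · simp at hu
    · exact spectrum.mem_iff.mp hk ((isUnit_smul_iff (Units.mk0 β hβ0) _).mp hu)
  have h2 : ‖(Submodule.Quotient.mk 1 : U ⧸ S)‖ = 1 :=
    le_antisymm ((Submodule.Quotient.norm_mk_le S 1).trans_eq CStarRing.norm_one) h1
  obtain ⟨g, hg, hg1⟩ := exists_dual_vector ℂ (Submodule.Quotient.mk 1 : U ⧸ S) (by simp [h2])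
  rw [h2] at hg1
  have hfa : g (Submodule.Quotient.mk a : U ⧸ S) = k := by
    have h3 : (Submodule.Quotient.mk a : U ⧸ S) = k • Submodule.Quotient.mk 1 := by
      rw [← Submodule.Quotient.mk_smul, ← Algebra.algebraMap_eq_smul_one, eq_comm,
        Submodule.Quotient.eq]
      exact Submodule.mem_span_singleton_self _
    rw [h3, map_smul, hg1]
    simp
  have hb (x : U) : ‖(g.toLinearMap ∘ₗ S.mkQ) x‖ ≤ 1 * ‖x‖ :=
    (g.le_opNorm _).trans (by rw [hg]; gcongr; exact Submodule.Quotient.norm_mk_le S x)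
  exact ⟨(g.toLinearMap ∘ₗ S.mkQ).mkContinuous 1 hb,
    LinearMap.mkContinuous_norm_le _ zero_le_one _, by simpa using hg1, by simpa using hfa⟩

/-- In the unitization, `‖star c * c‖` is a spectral value of `star c * c`, hence a value of a
unital contractive functional. Its restriction to `D` still has norm one because the norm is
attained at `star c * c`. -/
theorem exists_state_apply_ne_zero {D : Type*} [NonUnitalCStarAlgebra D] {c : D} (hc : c ≠ 0) :
    ∃ ψ : MinimalTensor.State D, ψ.toCLM (star c * c) ≠ 0 := by
  set a : Unitization ℂ D := ((star c * c : D) : Unitization ℂ D) with ha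
  have ha0 : 0 ≤ a := by
    rw [ha, Unitization.inr_mul, Unitization.inr_star]
    exact star_mul_self_nonneg _
  have hna : ‖a‖ = ‖star c * c‖ := Unitization.norm_inr _
  have hne : ‖a‖ ≠ 0 := by
    rw [hna, CStarRing.norm_star_mul_self]
    simpa using hc
  obtain ⟨f, hf, hf1, hfa⟩ := exists_apply_one_of_spectrum a (k := (‖a‖ : ℂ))
    (spectrum.algebraMap_mem ℂ (CStarAlgebra.norm_mem_spectrum_of_nonneg ha0))
  have hb (x : D) : ‖(f.toLinearMap ∘ₗ Unitization.inrHom ℂ ℂ D) x‖ ≤ 1 * ‖x‖ := by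
    refine (f.le_opNorm _).trans ?_
    gcongr
    exact (Unitization.norm_inr (𝕜 := ℂ) x).le
  set ψ : D →L[ℂ] ℂ := (f.toLinearMap ∘ₗ Unitization.inrHom ℂ ℂ D).mkContinuous 1 hb with hψ
  have hψa : ψ (star c * c) = ‖a‖ := hfa
  refine ⟨⟨ψ, fun x => ?_, le_antisymm (LinearMap.mkContinuous_norm_le _ zero_le_one _) ?_⟩, ?_⟩
  · refine apply_nonneg_of_apply_one f hf hf1 (x := ((star x * x : D) : Unitization ℂ D)) ?_
    rw [Unitization.inr_mul, Unitization.inr_star]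
    exact star_mul_self_nonneg _
  · have := ψ.le_opNorm (star c * c)
    rw [hψa, ← hna, Complex.norm_real, norm_norm] at this
    exact le_of_mul_le_mul_right (by simpa using this) ((norm_nonneg a).lt_of_ne' hne)
  · change ψ (star c * c) ≠ 0
    rw [hψa]
    exact_mod_cast hne

theorem MinimalTensor.State.eq_zero_of_forall_rep {D : Type*} [NonUnitalCStarAlgebra D] {d : D}
    (h : ∀ ψ : MinimalTensor.State D, ψ.rep d = 0) : d = 0 := by
  by_contra hd
  -- The GNS space comes with no cyclic vector, so `π_ψ d` is tested on the vector of `star d`.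
  have hc : d * star d ≠ 0 := by simpa using hd
  obtain ⟨ψ, hψ⟩ := exists_state_apply_ne_zero hc
  refine hψ ?_
  have : ψ.vec (d * star d) = 0 := by rw [← ψ.rep_vec, h ψ]; rfl
  rw [← ψ.inner_vec, this, inner_zero_left]

end States

/-- A jointly injective family of ⋆-representations of a C⋆-algebra determines its norm. -/
theorem norm_le_of_forall_norm_le {A : Type*} [NonUnitalCStarAlgebra A] {ι : Type*}
    {B : ι → Type*} [∀ i, NonUnitalCStarAlgebra (B i)] (π : ∀ i, A →⋆ₙₐ[ℂ] B i)
    (hπ : ∀ a, (∀ i, π i a = 0) → a = 0) {a : A} {r : ℝ} (hr : 0 ≤ r)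
    (h : ∀ i, ‖π i a‖ ≤ r) : ‖a‖ ≤ r := by
  let F : A →⋆ₙₐ[ℂ] lp B ∞ :=
    { toFun := fun a => ⟨fun i => π i a, memℓp_infty ⟨‖a‖, by
        rintro _ ⟨i, rfl⟩; exact NonUnitalStarAlgHom.norm_apply_le (π i) a⟩⟩
      map_smul' := fun r z => lp.ext (funext fun i => map_smul (π i) r z)
      map_zero' := lp.ext (funext fun i => map_zero (π i))
      map_add' := fun x y => lp.ext (funext fun i => map_add (π i) x y)
      map_mul' := fun x y => lp.ext (funext fun i => map_mul (π i) x y)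
      map_star' := fun x => lp.ext (funext fun i => map_star (π i) x) }
  have hF : Function.Injective F := by
    refine (injective_iff_map_eq_zero F).mpr fun x hx => hπ x fun i => ?_
    exact congrFun (congrArg Subtype.val hx) i
  rw [← NonUnitalStarAlgHom.norm_map F hF a]
  exact lp.norm_le_of_forall_le hr h

/-! ### Matrix amplifications of representations -/

section Amplification

variable {D K L ι : Type*} [NonUnitalCStarAlgebra D] [NormedAddCommGroup K] [InnerProductSpace ℂ K]
  [CompleteSpace K] [NormedAddCommGroup L] [InnerProductSpace ℂ L] [CompleteSpace L] [Fintype ι]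
  [DecidableEq ι]

open ContinuousLinearMap

/-- Given isometries `V i : K → L` with orthogonal ranges, a ⋆-representation `π` on `K` induces
the ⋆-representation `M ↦ ∑ i j, V i * π (M i j) * (V j)†` of the matrix algebra on `L`. -/
def amplification (π : D →⋆ₙₐ[ℂ] (K →L[ℂ] K)) (V : ι → K →L[ℂ] L)
    (hV : ∀ i j, adjoint (V i) ∘L V j = if i = j then 1 else 0) :
    CStarMatrix ι ι D →⋆ₙₐ[ℂ] (L →L[ℂ] L) where
  toFun M := ∑ i, ∑ j, V i ∘L π (M i j) ∘L adjoint (V j)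
  map_smul' r M := by simp [Finset.smul_sum]
  map_zero' := by simp
  map_add' M N := by simp [Finset.sum_add_distrib]
  map_mul' M N := by
    have key (i j k l : ι) : (V i ∘L π (M i j) ∘L adjoint (V j)) *
        (V k ∘L π (N k l) ∘L adjoint (V l)) =
        if j = k then V i ∘L π (M i j * N j l) ∘L adjoint (V l) else 0 := by
      have : (V i ∘L π (M i j) ∘L adjoint (V j)) * (V k ∘L π (N k l) ∘L adjoint (V l)) =
          V i ∘L π (M i j) ∘L (adjoint (V j) ∘L V k) ∘L π (N k l) ∘L adjoint (V l) := rfl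
      rw [this, hV]
      split_ifs with h
      · subst h
        rw [map_mul]
        rfl
      · simp
    simp only [Finset.sum_mul, Finset.mul_sum, key, CStarMatrix.mul_apply, map_sum]
    simp only [Finset.sum_ite_eq', Finset.mem_univ, if_true, finsetSum_comp, comp_finsetSum]
    symm
    calc _ = ∑ k, ∑ i, ∑ l, V i ∘L π (M i k * N k l) ∘L adjoint (V l) :=
          Finset.sum_congr rfl fun k _ => Finset.sum_comm
      _ = ∑ i, ∑ k, ∑ l, V i ∘L π (M i k * N k l) ∘L adjoint (V l) := Finset.sum_comm
      _ = _ := Finset.sum_congr rfl fun i _ => Finset.sum_comm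
  map_star' M := by
    simp only [star_sum, star_eq_adjoint, adjoint_comp, adjoint_adjoint, CStarMatrix.star_apply, map_star]
    rw [Finset.sum_comm]
    rfl

theorem amplification_apply (π : D →⋆ₙₐ[ℂ] (K →L[ℂ] K)) (V : ι → K →L[ℂ] L)
    (hV : ∀ i j, adjoint (V i) ∘L V j = if i = j then 1 else 0) (M : CStarMatrix ι ι D) :
    amplification π V hV M = ∑ i, ∑ j, V i ∘L π (M i j) ∘L adjoint (V j) := rfl

/-- The entries of `M` can be read off its amplification; this turns joint injectivity of
representations of `D` into joint injectivity on matrices. -/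
theorem adjoint_comp_amplification_comp (π : D →⋆ₙₐ[ℂ] (K →L[ℂ] K)) (V : ι → K →L[ℂ] L)
    (hV : ∀ i j, adjoint (V i) ∘L V j = if i = j then 1 else 0) (M : CStarMatrix ι ι D) (i j : ι) :
    adjoint (V i) ∘L amplification π V hV M ∘L V j = π (M i j) := by
  have key (k l : ι) : adjoint (V i) ∘L (V k ∘L π (M k l) ∘L adjoint (V l)) ∘L V j =
      if i = k then if l = j then π (M i j) else 0 else 0 := by
    have : adjoint (V i) ∘L (V k ∘L π (M k l) ∘L adjoint (V l)) ∘L V j =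
      (adjoint (V i) ∘L V k) ∘L π (M k l) ∘L (adjoint (V l) ∘L V j) := rfl
    rw [this, hV, hV]
    split_ifs with h1 h2
    · subst h1 h2; rfl
    · simp
    · simp
    · simp
  simp [amplification_apply, finsetSum_comp, comp_finsetSum, key]

/-- The projection onto the sum of the ranges of the isometries `V i`. -/
def rangeProj (V : ι → K →L[ℂ] L) : L →L[ℂ] L := ∑ i, V i ∘L adjoint (V i)

theorem norm_rangeProj_le (V : ι → K →L[ℂ] L)
    (hV : ∀ i j, adjoint (V i) ∘L V j = if i = j then 1 else 0) : ‖rangeProj V‖ ≤ 1 := by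
  have hp : IsStarProjection (rangeProj V) := by
    constructor
    · have key (i j : ι) : (V i ∘L adjoint (V i)) * (V j ∘L adjoint (V j)) =
          if i = j then V i ∘L adjoint (V i) else 0 := by
        have : (V i ∘L adjoint (V i)) * (V j ∘L adjoint (V j)) =
          V i ∘L (adjoint (V i) ∘L V j) ∘L adjoint (V j) := rfl
        rw [this, hV]
        split_ifs with h
        · subst h; rfl
        · simp
      simp [IsIdempotentElem, rangeProj, Finset.sum_mul, Finset.mul_sum, key]
    · simp [IsSelfAdjoint, rangeProj, star_eq_adjoint, adjoint_comp]
  exact hp.norm_le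

/-- If `T` is a compression of the matrix `M`, then the amplification of `M` is a corner of `T`. -/
theorem amplification_eq_rangeProj_mul (π : D →⋆ₙₐ[ℂ] (K →L[ℂ] K)) (V : ι → K →L[ℂ] L)
    (hV : ∀ i j, adjoint (V i) ∘L V j = if i = j then 1 else 0) (M : CStarMatrix ι ι D)
    (T : L →L[ℂ] L) (hT : ∀ i j, adjoint (V i) ∘L T ∘L V j = π (M i j)) :
    amplification π V hV M = rangeProj V * T * rangeProj V := by
  simp only [rangeProj, amplification_apply, Finset.sum_mul, Finset.mul_sum, ← hT]
  rw [Finset.sum_comm]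
  rfl

end Amplification

/-! ### Conditional expectations are completely contractive -/

section ConditionalExpectation

attribute [local instance] CStarAlgebra.spectralOrder CStarAlgebra.spectralOrderedRing

open WithCStarModule in
-- The new matrix has entries in the C⋆-algebra `P`, so its norm can be tested on vectors over `P`
-- alone. On these the bimodule property pulls `E` out of the inner product, and contractivity of
-- `E` on `D` suffices.
theorem IsConditionalExpectation.norm_matrix_map_le {D : Type*} [NonUnitalCStarAlgebra D]
    {P : NonUnitalStarSubalgebra ℂ D} (hP : IsClosed (P : Set D)) {E : D →ₗ[ℂ] D}
    (hE : IsConditionalExpectation P E) {ι : Type*} [Fintype ι] (M : CStarMatrix ι ι D) :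
    ‖M.mapₗ E‖ ≤ ‖M‖ := by
  have : IsClosed (P : Set D) := hP
  let _ : PartialOrder P := CStarAlgebra.spectralOrder P
  have : StarOrderedRing P := CStarAlgebra.spectralOrderedRing P
  let N : CStarMatrix ι ι P := CStarMatrix.ofMatrix fun i j => ⟨E (M i j), hE.mem _⟩
  let inc := NonUnitalStarSubalgebraClass.subtype P
  have hN : CStarMatrix.mapₙₐ inc N = M.mapₗ E := rfl
  have hinj : Function.Injective (CStarMatrix.mapₙₐ (n := ι) inc) := by
    intro x y hxy
    ext i j
    exact congrFun (congrFun hxy i) j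
  -- Injective ⋆-homomorphisms are isometric, so the norm may be computed over `P`.
  rw [← hN, NonUnitalStarAlgHom.norm_map _ hinj]
  refine CStarMatrix.norm_le_of_forall_inner_le (C := ‖M‖₊) fun v w => ?_
  let v' : C⋆ᵐᵒᵈ(D, ι → D) := (equiv D (ι → D)).symm fun i => (v i : D)
  let w' : C⋆ᵐᵒᵈ(D, ι → D) := (equiv D (ι → D)).symm fun i => (w i : D)
  have hnorm (u : C⋆ᵐᵒᵈ(P, ι → P)) :
      ‖(equiv D (ι → D)).symm fun i => (u i : D)‖ = ‖u‖ := by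
    rw [pi_norm, pi_norm]
    simp [inner_def]
  have hinner : ((inner P w (CStarMatrix.toCLM N v) : P) : D) =
      E (inner D w' (CStarMatrix.toCLM M v')) := by
    simp only [pi_inner, CStarMatrix.toCLM_apply_eq_sum]
    simp only [inner_def, equiv_symm_pi_apply, AddSubmonoidClass.coe_finsetSum, MulMemClass.coe_mul,
      Finset.sum_mul, map_sum, StarMemClass.coe_star]
    refine Finset.sum_congr rfl fun j _ => Finset.sum_congr rfl fun i _ => ?_
    change _ = E ((v i : D) * M i j * star (w j : D))
    rw [hE.map_mul_right _ _ (star_mem (w j).2), hE.map_mul_left _ (v i).2]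
    rfl
  calc ‖(inner P w (CStarMatrix.toCLM N v) : P)‖ = ‖E (inner D w' (CStarMatrix.toCLM M v'))‖ := by
        rw [← hinner]; rfl
    _ ≤ ‖inner D w' (CStarMatrix.toCLM M v')‖ := hE.norm_le _
    _ ≤ ‖w'‖ * ‖CStarMatrix.toCLM M v'‖ := CStarModule.norm_inner_le _
    _ ≤ ‖w'‖ * (‖M‖ * ‖v'‖) := by gcongr; exact (CStarMatrix.toCLM M).le_opNorm v'
    _ = ‖M‖ * ‖v‖ * ‖w‖ := by rw [hnorm, hnorm]; ring

end ConditionalExpectation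

namespace MinimalTensor

open ContinuousLinearMap

/-! ### Compressions of operators on a Hilbert space tensor product -/

section TmulLeft

variable {H K : Type*} [NormedAddCommGroup H] [InnerProductSpace ℂ H]
  [NormedAddCommGroup K] [InnerProductSpace ℂ K]

/-- The operator `k ↦ h ⊗ k` into the Hilbert space tensor product. -/
def tmulLeft (h : H) : K →L[ℂ] HilbertTensor H K :=
  ((HilbertTensor.incl H K).toLinearMap ∘ₗ TensorProduct.mk ℂ H K h).mkContinuous ‖h‖ fun k => by
    change ‖HilbertTensor.incl H K (h ⊗ₜ k)‖ ≤ _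
    rw [LinearIsometry.norm_map, TensorProduct.norm_tmul]

theorem tmulLeft_apply (h : H) (k : K) : tmulLeft h k = HilbertTensor.incl H K (h ⊗ₜ k) := rfl

variable [CompleteSpace K]

theorem adjoint_tmulLeft_incl (h a : H) (b : K) :
    adjoint (tmulLeft h) (HilbertTensor.incl H K (a ⊗ₜ b)) = inner ℂ h a • b := by
  refine ext_inner_left ℂ fun v => ?_
  rw [adjoint_inner_right, tmulLeft_apply, LinearIsometry.inner_map_map,
    TensorProduct.inner_tmul, inner_smul_right]

theorem adjoint_tmulLeft_comp_tmulLeft {ι : Type*} [DecidableEq ι] {h : ι → H}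
    (hh : Orthonormal ℂ h) (i j : ι) :
    adjoint (tmulLeft (K := K) (h i)) ∘L tmulLeft (h j) = if i = j then 1 else 0 := by
  ext k
  rw [comp_apply, tmulLeft_apply, adjoint_tmulLeft_incl, orthonormal_iff_ite.mp hh]
  split_ifs <;> simp

/-- Every element of the algebraic tensor product is fixed by the projection onto
`span h ⊗ K` for a finite orthonormal family `h` spanning a large enough subspace. -/
theorem exists_submodule_forall_rangeProj (x : H ⊗[ℂ] K) :
    ∃ F : Submodule ℂ H, FiniteDimensional ℂ F ∧ ∀ F' : Submodule ℂ H, F ≤ F' →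
      ∀ {n : ℕ} (b : OrthonormalBasis (Fin n) ℂ F'),
        rangeProj (fun i => tmulLeft (K := K) (b i : H)) (HilbertTensor.incl H K x) =
          HilbertTensor.incl H K x := by
  induction x using TensorProduct.induction_on with
  | zero => exact ⟨⊥, inferInstance, fun F' _ n b => by simp⟩
  | add x y hx hy =>
    obtain ⟨F, hF, hx⟩ := hx
    obtain ⟨G, hG, hy⟩ := hy
    exact ⟨F ⊔ G, inferInstance, fun F' hF' n b => by
      rw [map_add, map_add, hx F' (le_sup_left.trans hF') b, hy F' (le_sup_right.trans hF') b]⟩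
  | tmul a c =>
    refine ⟨Submodule.span ℂ {a}, inferInstance, fun F' hF' n b => ?_⟩
    have ha : a ∈ F' := hF' (Submodule.mem_span_singleton_self a)
    have hsum : ∑ i, inner ℂ (b i : H) a • (b i : H) = a := by
      have := congrArg Subtype.val (b.sum_repr' ⟨a, ha⟩)
      simpa using this
    simp only [rangeProj, sum_apply, comp_apply, adjoint_tmulLeft_incl, map_smul, tmulLeft_apply]
    conv_rhs => rw [← hsum]
    simp only [TensorProduct.sum_tmul, map_sum, ← TensorProduct.smul_tmul', map_smul]

/-- A bound for an operator on the Hilbert space tensor product by its compressions to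
`F ⊗ K`, with `F` a finite-dimensional subspace. -/
theorem norm_le_of_forall_norm_compression_le (T : HilbertTensor H K →L[ℂ] HilbertTensor H K)
    {r : ℝ} (hr : 0 ≤ r)
    (h : ∀ (n : ℕ) (b : Fin n → H), Orthonormal ℂ b →
      ‖rangeProj (fun i => tmulLeft (K := K) (b i)) * T *
        rangeProj (fun i => tmulLeft (K := K) (b i))‖ ≤ r) : ‖T‖ ≤ r := by
  have key (x y : H ⊗[ℂ] K) : ‖inner ℂ (HilbertTensor.incl H K x) (T (HilbertTensor.incl H K y))‖ ≤
      r * ‖HilbertTensor.incl H K x‖ * ‖HilbertTensor.incl H K y‖ := by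
    obtain ⟨F, hF, hx⟩ := exists_submodule_forall_rangeProj x
    obtain ⟨G, hG, hy⟩ := exists_submodule_forall_rangeProj y
    -- A basis of the sum of both subspaces makes one projection `Q` fix both vectors.
    let b := stdOrthonormalBasis ℂ (F ⊔ G : Submodule ℂ H)
    set Q := rangeProj (fun i => tmulLeft (K := K) (b i : H)) with hQ
    have hx' := hx _ le_sup_left b
    have hy' := hy _ le_sup_right b
    have hb : Orthonormal ℂ (fun i => (b i : H)) :=
      b.orthonormal.comp_linearIsometry (F ⊔ G : Submodule ℂ H).subtypeₗᵢ
    have hadj : adjoint Q = Q := by simp [hQ, rangeProj, adjoint_comp]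
    have : inner ℂ (HilbertTensor.incl H K x) (T (HilbertTensor.incl H K y)) =
        inner ℂ (HilbertTensor.incl H K x) ((Q * T * Q) (HilbertTensor.incl H K y)) := by
      change _ = inner ℂ _ (Q (T (Q (HilbertTensor.incl H K y))))
      rw [hy', ← adjoint_inner_left Q, hadj, hx']
    rw [this]
    refine (norm_inner_le_norm _ _).trans ?_
    have := ((Q * T * Q).le_opNorm (HilbertTensor.incl H K y)).trans
      (mul_le_mul_of_nonneg_right (h _ _ hb) (norm_nonneg _))
    nlinarith [norm_nonneg (HilbertTensor.incl H K x)]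
  have key' (x y : HilbertTensor H K) : ‖inner ℂ x (T y)‖ ≤ r * ‖x‖ * ‖y‖ :=
    HilbertTensor.denseRange_incl.induction_on₂
      (p := fun x y => ‖inner ℂ x (T y)‖ ≤ r * ‖x‖ * ‖y‖)
      (isClosed_le (by fun_prop) (by fun_prop)) key x y
  refine T.opNorm_le_bound hr fun y => ?_
  rcases (norm_nonneg (T y)).eq_or_lt with h0 | h0
  · rw [← h0]; positivity
  · have := key' (T y) y
    rw [inner_self_eq_norm_sq_to_K] at this
    simp at this
    nlinarith

end TmulLeft

/-! ### Slice maps and contractivity of `id ⊗ E` -/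

variable {C D : Type*} [NonUnitalCStarAlgebra C] [NonUnitalCStarAlgebra D]

/-- The slice map `⟨h, π_φ(·) k⟩ ⊗ id`. -/
def slice (φ : State C) (h k : φ.Hilb) : C ⊗[ℂ] D →ₗ[ℂ] D :=
  TensorProduct.lid ℂ D ∘ₗ TensorProduct.map
    ((innerSL ℂ h).toLinearMap ∘ₗ (ContinuousLinearMap.apply ℂ φ.Hilb k).toLinearMap ∘ₗ
      (φ.rep : C →ₗ[ℂ] (φ.Hilb →L[ℂ] φ.Hilb))) LinearMap.id

theorem slice_tmul (φ : State C) (h k : φ.Hilb) (c : C) (d : D) :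
    slice φ h k (c ⊗ₜ d) = inner ℂ h (φ.rep c k) • d := rfl

theorem slice_lTensor (φ : State C) (h k : φ.Hilb) (E : D →ₗ[ℂ] D) (z : C ⊗[ℂ] D) :
    slice φ h k (E.lTensor C z) = E (slice φ h k z) := by
  induction z using TensorProduct.induction_on with
  | zero => simp
  | add x y hx hy => simp only [map_add, hx, hy]
  | tmul c d => simp only [LinearMap.lTensor_tmul, slice_tmul, map_smul]

/-- On elementary tensors both sides are `⟨h, π_φ(c) k⟩ π_ψ(d)`. The slice does not depend on `ψ`,
so one matrix over `D` serves all states of `D`. -/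
theorem adjoint_tmulLeft_pairRep_tmulLeft (φ : State C) (ψ : State D) (h k : φ.Hilb)
    (z : C ⊗[ℂ] D) :
    adjoint (tmulLeft h) ∘L pairRep φ ψ z ∘L tmulLeft k = ψ.rep (slice φ h k z) := by
  induction z using TensorProduct.induction_on with
  | zero => simp
  | add x y hx hy => simp only [map_add, add_comp, comp_add, hx, hy]
  | tmul c d =>
    ext x
    change adjoint (tmulLeft h) (opTensor (φ.rep c) (ψ.rep d) (tmulLeft k x)) = _
    rw [tmulLeft_apply, opTensor_incl, TensorProduct.mapL_tmul, adjoint_tmulLeft_incl, slice_tmul,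
      map_smul]
    rfl

section

attribute [local instance] CStarAlgebra.spectralOrder CStarAlgebra.spectralOrderedRing

/-- The matrix over `D` of slices of an element of `C ⊗ D`. -/
def sliceMatrix (φ : State C) {n : ℕ} (b : Fin n → φ.Hilb) (z : C ⊗[ℂ] D) :
    CStarMatrix (Fin n) (Fin n) D :=
  CStarMatrix.ofMatrix fun i j => slice φ (b i) (b j) z

theorem norm_pairRep_le (φ : State C) (ψ : State D) (z : C ⊗[ℂ] D) :
    ‖pairRep φ ψ z‖ ≤ ‖spatialRep C D z‖ := by
  obtain ⟨K, hK⟩ := exists_norm_pairRep_le z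
  rw [norm_spatialRep]
  exact le_ciSup (f := fun i : State C × State D => ‖pairRep i.1 i.2 z‖)
    ⟨K, by rintro _ ⟨i, rfl⟩; exact hK i⟩ (φ, ψ)

/-- Amplified GNS representations are jointly injective on matrices over `D`, and each sends the
slice matrix to a corner of `π_φ ⊗ π_ψ` at `z`. -/
theorem norm_sliceMatrix_le (φ : State C) {n : ℕ} (b : Fin n → φ.Hilb) (hb : Orthonormal ℂ b)
    (z : C ⊗[ℂ] D) : ‖sliceMatrix φ b z‖ ≤ ‖spatialRep C D z‖ := by
  have hV (ψ : State D) := adjoint_tmulLeft_comp_tmulLeft (K := ψ.Hilb) hb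
  refine norm_le_of_forall_norm_le (fun ψ : State D => amplification ψ.rep
    (fun i => tmulLeft (K := ψ.Hilb) (b i)) (hV ψ)) (fun M hM => ?_) (norm_nonneg _) fun ψ => ?_
  · ext i j
    refine State.eq_zero_of_forall_rep fun ψ => ?_
    rw [← adjoint_comp_amplification_comp ψ.rep _ (hV ψ), hM ψ]
    simp
  · have hn := norm_rangeProj_le _ (hV ψ)
    rw [amplification_eq_rangeProj_mul ψ.rep _ (hV ψ) (sliceMatrix φ b z) (pairRep φ ψ z)
      fun i j => adjoint_tmulLeft_pairRep_tmulLeft φ ψ (b i) (b j) z]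
    calc _ ≤ 1 * ‖pairRep φ ψ z‖ * 1 := by
          refine (norm_mul_le _ _).trans ?_
          gcongr
          refine (norm_mul_le _ _).trans ?_
          gcongr
      _ ≤ _ := by simpa using norm_pairRep_le φ ψ z

theorem norm_pairRep_le_of_forall_sliceMatrix (φ : State C) (ψ : State D) (z : C ⊗[ℂ] D) {r : ℝ}
    (hr : 0 ≤ r) (h : ∀ (n : ℕ) (b : Fin n → φ.Hilb), Orthonormal ℂ b → ‖sliceMatrix φ b z‖ ≤ r) :
    ‖pairRep φ ψ z‖ ≤ r := by
  refine norm_le_of_forall_norm_compression_le _ hr fun n b hb => ?_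
  have hV := adjoint_tmulLeft_comp_tmulLeft (K := ψ.Hilb) hb
  rw [← amplification_eq_rangeProj_mul ψ.rep _ hV (sliceMatrix φ b z) (pairRep φ ψ z)
      fun i j => adjoint_tmulLeft_pairRep_tmulLeft φ ψ (b i) (b j) z]
  exact (NonUnitalStarAlgHom.norm_apply_le _ _).trans (h n b hb)

/-- Applying a conditional expectation to the second factor is contractive for the minimal norm. -/
theorem norm_spatialRep_lTensor_le {P : NonUnitalStarSubalgebra ℂ D} (hP : IsClosed (P : Set D))
    {E : D →ₗ[ℂ] D} (hE : IsConditionalExpectation P E) (z : C ⊗[ℂ] D) :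
    ‖spatialRep C D (E.lTensor C z)‖ ≤ ‖spatialRep C D z‖ := by
  rw [norm_spatialRep (E.lTensor C z)]
  refine Real.iSup_le (fun i => ?_) (norm_nonneg _)
  refine norm_pairRep_le_of_forall_sliceMatrix i.1 i.2 _ (norm_nonneg _) fun n b hb => ?_
  have : sliceMatrix i.1 b (E.lTensor C z) = (sliceMatrix i.1 b z).mapₗ E := by
    ext j k
    exact slice_lTensor i.1 (b j) (b k) E z
  rw [this]
  exact (hE.norm_matrix_map_le hP _).trans (norm_sliceMatrix_le i.1 b hb z)

end

/-! ### The retraction of the minimal tensor product -/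

theorem denseRange_ofAlgebraic : DenseRange (ofAlgebraic C D) := by
  intro x
  refine closure_subtype.mpr (closure_mono ?_ x.2)
  rintro _ ⟨z, rfl⟩
  exact ⟨_, ⟨z, rfl⟩, rfl⟩

/-- The map `id ⊗ E` on the minimal tensor product. -/
def sliceExtension (E : D →ₗ[ℂ] D) : MinTensor C D →L[ℂ] MinTensor C D :=
  ((ofAlgebraic C D : C ⊗[ℂ] D →ₗ[ℂ] MinTensor C D) ∘ₗ E.lTensor C).extendOfNorm
    (ofAlgebraic C D : C ⊗[ℂ] D →ₗ[ℂ] MinTensor C D)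

variable {P : NonUnitalStarSubalgebra ℂ D} {E : D →ₗ[ℂ] D}

theorem sliceExtension_ofAlgebraic (hP : IsClosed (P : Set D)) (hE : IsConditionalExpectation P E)
    (z : C ⊗[ℂ] D) :
    sliceExtension E (ofAlgebraic C D z) = ofAlgebraic C D (E.lTensor C z) :=
  LinearMap.extendOfNorm_eq denseRange_ofAlgebraic
    ⟨1, fun x => by rw [one_mul]; exact norm_spatialRep_lTensor_le hP hE x⟩ z

theorem norm_sliceExtension_le (hP : IsClosed (P : Set D)) (hE : IsConditionalExpectation P E)
    (x : MinTensor C D) : ‖sliceExtension E x‖ ≤ ‖x‖ := by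
  refine (LinearMap.norm_extendOfNorm_apply_le denseRange_ofAlgebraic 1
    (fun x => ?_) x).trans_eq (one_mul _)
  rw [one_mul]
  exact norm_spatialRep_lTensor_le hP hE x

theorem sliceExtension_mem (hP : IsClosed (P : Set D)) (hE : IsConditionalExpectation P E)
    (A : NonUnitalStarSubalgebra ℂ C) {x : MinTensor C D} (hx : x ∈ minTensorSub A ⊤) :
    sliceExtension E x ∈ minTensorSub A P := by
  refine map_mem_closure (sliceExtension E).continuous hx ?_
  rintro _ ⟨z, hz, rfl⟩
  refine ⟨E.lTensor C z, ?_, (sliceExtension_ofAlgebraic hP hE z).symm⟩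
  change z ∈ Submodule.span ℂ _ at hz
  induction hz using Submodule.span_induction with
  | zero => simp
  | add x y _ _ hx hy => rw [map_add]; exact add_mem hx hy
  | smul r x _ hx => rw [map_smul]; exact (algTensor A P).smul_mem' r hx
  | mem x hx =>
    obtain ⟨a, ha, d, -, rfl⟩ := hx
    exact Submodule.subset_span ⟨a, ha, E d, hE.mem d, rfl⟩

theorem sliceExtension_eq_self (hP : IsClosed (P : Set D)) (hE : IsConditionalExpectation P E)
    (A : NonUnitalStarSubalgebra ℂ C) {x : MinTensor C D} (hx : x ∈ minTensorSub A P) :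
    sliceExtension E x = x := by
  refine closure_minimal (t := {x | sliceExtension E x = x}) ?_
    (isClosed_eq (sliceExtension E).continuous continuous_id) hx
  rintro _ ⟨z, hz, rfl⟩
  refine (sliceExtension_ofAlgebraic hP hE z).trans (congrArg _ ?_)
  change z ∈ Submodule.span ℂ _ at hz
  induction hz using Submodule.span_induction with
  | zero => simp
  | add x y _ _ hx hy => rw [map_add, hx, hy]
  | smul r x _ hx => rw [map_smul, hx]
  | mem x hx =>
    obtain ⟨a, -, p, hp, rfl⟩ := hx
    rw [LinearMap.lTensor_tmul, hE.apply_of_mem p hp]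

theorem minTensorSub_mono (A : NonUnitalStarSubalgebra ℂ C) {P Q : NonUnitalStarSubalgebra ℂ D}
    (h : P ≤ Q) : minTensorSub A P ≤ minTensorSub A Q := by
  refine closure_mono (Set.image_mono ?_)
  exact Submodule.span_mono fun _ ⟨a, ha, p, hp, hz⟩ => ⟨a, ha, p, h hp, hz⟩

end MinimalTensor

/-! ### Distances decrease under contractive retractions -/

section Distances

variable {M : Type*} [NonUnitalCStarAlgebra M] {A B A' B' : NonUnitalStarSubalgebra ℂ M}

theorem NearIncl.of_retraction {γ : ℝ} (F : M →L[ℂ] M) (hF : ∀ x, ‖F x‖ ≤ ‖x‖)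
    (hA : A' ≤ A) (hFA : ∀ x ∈ A', F x = x) (hFB : ∀ x ∈ B, F x ∈ B') (h : NearIncl γ A B) :
    NearIncl γ A' B' := by
  intro x hx
  obtain ⟨y, hy, hxy⟩ := h x ⟨hA hx.1, hx.2⟩
  refine ⟨F y, hFB y hy, ?_⟩
  rw [← hFA x hx.1, ← map_sub]
  exact (hF _).trans hxy

theorem distC_le_of_retraction (F : M →L[ℂ] M) (hF : ∀ x, ‖F x‖ ≤ ‖x‖)
    (hA : A' ≤ A) (hFA' : ∀ x ∈ A', F x = x) (hFA : ∀ x ∈ A, F x ∈ A')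
    (hB : B' ≤ B) (hFB' : ∀ x ∈ B', F x = x) (hFB : ∀ x ∈ B, F x ∈ B') :
    distC A' B' ≤ distC A B := by
  -- The value `γ = 1` is always admissible, with `0` as the approximant, so the infimum is not over
  -- the empty set.
  refine csInf_le_csInf ⟨0, fun γ hγ => hγ.1.le⟩ ⟨1, one_pos, ?_, ?_⟩ ?_
  · exact fun x hx => ⟨0, zero_mem _, by simpa using hx.2⟩
  · exact fun x hx => ⟨0, zero_mem _, by simpa using hx.2⟩
  · exact fun γ ⟨h0, h1, h2⟩ => ⟨h0, h1.of_retraction F hF hA hFA' hFB,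
      h2.of_retraction F hF hB hFB' hFA⟩

theorem unitBall_nonempty (A : NonUnitalStarSubalgebra ℂ M) : (unitBall A).Nonempty :=
  ⟨0, zero_mem _, by simp⟩

theorem isBounded_unitBall (A : NonUnitalStarSubalgebra ℂ M) :
    Bornology.IsBounded (unitBall A) :=
  isBounded_iff_forall_norm_le.mpr ⟨1, fun _ hx => hx.2⟩

theorem infDist_unitBall_le_of_retraction (F : M →L[ℂ] M) (hF : ∀ x, ‖F x‖ ≤ ‖x‖)
    (hFB : ∀ x ∈ B, F x ∈ B') {x : M} (hx : F x = x) :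
    Metric.infDist x (unitBall B') ≤ Metric.infDist x (unitBall B) := by
  refine (Metric.le_infDist (unitBall_nonempty B)).mpr fun y hy => ?_
  have hFy : F y ∈ unitBall B' := ⟨hFB y hy.1, (hF y).trans hy.2⟩
  refine (Metric.infDist_le_dist_of_mem hFy).trans ?_
  conv_lhs => rw [← hx]
  rw [dist_eq_norm, dist_eq_norm, ← map_sub]
  exact hF _

theorem distKK_le_of_retraction (F : M →L[ℂ] M) (hF : ∀ x, ‖F x‖ ≤ ‖x‖)
    (hA : A' ≤ A) (hFA' : ∀ x ∈ A', F x = x) (hFA : ∀ x ∈ A, F x ∈ A')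
    (hB : B' ≤ B) (hFB' : ∀ x ∈ B', F x = x) (hFB : ∀ x ∈ B, F x ∈ B') :
    distKK A' B' ≤ distKK A B := by
  -- The real-valued Hausdorff distance bounds point distances only when the extended one is finite.
  have hfin : Metric.hausdorffEDist (unitBall A) (unitBall B) ≠ ⊤ :=
    Metric.hausdorffEDist_ne_top_of_nonempty_of_bounded (unitBall_nonempty A)
      (unitBall_nonempty B) (isBounded_unitBall A) (isBounded_unitBall B)
  refine Metric.hausdorffDist_le_of_infDist Metric.hausdorffDist_nonneg
    (fun x hx => (infDist_unitBall_le_of_retraction F hF hFB (hFA' x hx.1)).trans ?_)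
    fun x hx => (infDist_unitBall_le_of_retraction F hF hFA (hFB' x hx.1)).trans ?_
  · exact Metric.infDist_le_hausdorffDist_of_mem ⟨hA hx.1, hx.2⟩ hfin
  · rw [Metric.hausdorffEDist_comm] at hfin
    rw [distKK, Metric.hausdorffDist_comm]
    exact Metric.infDist_le_hausdorffDist_of_mem ⟨hB hx.1, hx.2⟩ hfin

end Distances

end

theorem proposition4p1 {C D : Type*} [NonUnitalCStarAlgebra C] [NonUnitalCStarAlgebra D]
    (A B : NonUnitalStarSubalgebra ℂ C) (hA : IsClosed (A : Set C)) (hB : IsClosed (B : Set C))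
    (P : NonUnitalStarSubalgebra ℂ D) (hP : IsClosed (P : Set D))
    (hE : ∃ E : D →ₗ[ℂ] D, IsConditionalExpectation P E) :
    distC (MinimalTensor.minTensorSub A P) (MinimalTensor.minTensorSub B P) ≤
        distC (MinimalTensor.minTensorSub A (⊤ : NonUnitalStarSubalgebra ℂ D))
          (MinimalTensor.minTensorSub B (⊤ : NonUnitalStarSubalgebra ℂ D)) ∧
      distKK (MinimalTensor.minTensorSub A P) (MinimalTensor.minTensorSub B P) ≤
        distKK (MinimalTensor.minTensorSub A (⊤ : NonUnitalStarSubalgebra ℂ D))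
          (MinimalTensor.minTensorSub B (⊤ : NonUnitalStarSubalgebra ℂ D)) := by

  obtain ⟨E, hE⟩ := hE
  have mem (X : NonUnitalStarSubalgebra ℂ C) := fun x hx =>
    MinimalTensor.sliceExtension_mem (x := x) hP hE X hx
  have fixed (X : NonUnitalStarSubalgebra ℂ C) := fun x hx =>
    MinimalTensor.sliceExtension_eq_self (x := x) hP hE X hx
  have mono (X : NonUnitalStarSubalgebra ℂ C) :=
    MinimalTensor.minTensorSub_mono X (le_top : P ≤ ⊤)
  have contr := MinimalTensor.norm_sliceExtension_le (C := C) hP hE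
  exact ⟨distC_le_of_retraction _ contr (mono A) (fixed A) (mem A) (mono B) (fixed B) (mem B),
    distKK_le_of_retraction _ contr (mono A) (fixed A) (mem A) (mono B) (fixed B) (mem B)⟩
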